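/- For a rational number $m/n$ in lowest terms ($m\in\mathbb Z$, $n\ge 1$, $\gcd(m,n)=1$) let $H(m/n)=\max\{|m|,n\}$. Let $p$ be a place of $\mathbb Q$, finite or infinite, and let $\mathbb Q_p$ be the completion of $\mathbb Q$ at $p$ (so $\mathbb Q_\infty=\mathbb R$). For $U\subseteq\mathbb Q_p$ with closure $\bar U$ let $$\mu(U)=\lim_{t\to\infty}\frac{\#\{r\in \bar U\cap\mathbb Q : H(r)\le t\}}{\#\{r\in\mathbb Q : H(r)\le t\}}$$ be the height measure of $U$, whenever this limit exists. A $p$-ball is a set $\{r\in\mathbb Q_p : |x-r|_p\le p^{-e}\}$ with $x\in\mathbb Q_p$, $e\in\mathbb Z$ if $p$ is finite, and a bounded interval (open, closed or half-open) with endpoints $a<b$ in $\mathbb R$ if $p=\infty$. Writing $|B|$ for the diameter of $B$, put, for $E\subseteq\mathbb Q_p$ and $\delta>0$, $$\mu_\delta(E)=\inf\Bigl\{\sum_i\mu(B_i) : (B_i)_i \text{ a countable family of } p\text{-balls},\ |B_i|\le\delta \text{ for all } i,\ E\subseteq\bigcup_i B_i\Bigr\},\qquad \mu^*(E)=\sup_{\delta>0}\mu_\delta(E).$$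 Theorem. For every place $p$ of $\mathbb Q$, the set function $\mu^*$ is an outer measure on $\mathbb Q_p$ which is $\sigma$-additive on the sets that are measurable for it in the sense of Carathéodory, every Borel subset of $\mathbb Q_p$ is measurable in this sense, and for every $p$-ball $B$ the limit $\mu(B)$ exists and $\mu^*(B)=\mu(B)$. -/

import Mathlib

open Filter Topology MeasureTheory
open scoped ENNReal

namespace HeightMeasure

noncomputable section

/-- The height `max {|m|, n}` of a rational number `m / n` in lowest terms, `n > 0`. -/
def height (r : ℚ) : ℕ := max r.num.natAbs r.den

/-- There are only finitely many rational numbers of bounded height (so that the cardinalities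
in `proportion` are cardinalities of finite sets). -/
theorem finite_height_le (t : ℝ) : {r : ℚ | (height r : ℝ) ≤ t}.Finite := by
  have hfin : ((Set.Icc (-(⌊t⌋₊ : ℤ)) ⌊t⌋₊) ×ˢ (Set.Icc 0 ⌊t⌋₊) : Set (ℤ × ℕ)).Finite :=
    (Set.finite_Icc _ _).prod (Set.finite_Icc _ _)
  refine Set.Finite.of_finite_image (f := fun r : ℚ => (r.num, r.den)) (hfin.subset ?_) ?_
  · rintro _ ⟨r, hr, rfl⟩
    have h : max r.num.natAbs r.den ≤ ⌊t⌋₊ := Nat.le_floor hr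
    simp only [Set.mem_prod, Set.mem_Icc]
    omega
  · intro a _ b _ hab
    simp only [Prod.mk.injEq] at hab
    exact Rat.ext hab.1 hab.2

section Completion

variable {K : Type*} [NormedField K]

/-- The proportion, among the rational numbers of height at most `t`, of those which lie in the
closure of `U`. -/
def proportion (U : Set K) (t : ℝ) : ℝ :=
  (Set.ncard {r : ℚ | (r : K) ∈ closure U ∧ (height r : ℝ) ≤ t} : ℝ) /
    (Set.ncard {r : ℚ | (height r : ℝ) ≤ t} : ℝ)

/-- `U` is `μ`-measurable: the limit which defines its height measure exists. -/
def HeightMeasurable (U : Set K) : Prop :=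
  ∃ l : ℝ, Tendsto (proportion U) atTop (𝓝 l)

/-- The height measure `μ(U)`, i.e. the limit of `proportion U t` for `t → ∞`
(meaningful if `HeightMeasurable U`). -/
def heightMeasure (U : Set K) : ℝ≥0∞ :=
  ENNReal.ofReal (limUnder atTop (proportion U))

/-- `μ_δ(E)`: the infimum of `∑ μ(B i)` over all countable (finite or infinite) covers of `E` by
members `B i` of the family `balls` whose diameter is at most `δ`. -/
def muDelta (balls : Set (Set K)) (δ : ℝ) (E : Set K) : ℝ≥0∞ :=
  ⨅ (I : Set ℕ) (B : ℕ → Set K)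
    (_ : ∀ i ∈ I, B i ∈ balls ∧ Metric.ediam (B i) ≤ ENNReal.ofReal δ)
    (_ : E ⊆ ⋃ i ∈ I, B i), ∑' i : I, heightMeasure (B i)

/-- `μ*(E) = sup_{δ > 0} μ_δ(E)`. -/
def muStar (balls : Set (Set K)) (E : Set K) : ℝ≥0∞ :=
  ⨆ (δ : ℝ) (_ : 0 < δ), muDelta balls δ E

end Completion

/-- The `p`-balls at a finite place `p`: the sets `{r ∈ ℚ_p : |x - r|_p ≤ p ^ (-e)}`. -/
def padicBalls (p : ℕ) [Fact p.Prime] : Set (Set ℚ_[p]) :=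
  {B | ∃ (x : ℚ_[p]) (e : ℤ), B = {r | ‖x - r‖ ≤ (p : ℝ) ^ (-e)}}

/-- The `p`-balls at the infinite place: the bounded real intervals
(closed, open or half-open) with endpoints `a < b`. -/
def realBalls : Set (Set ℝ) :=
  {B | ∃ a b : ℝ, a < b ∧
    (B = Set.Icc a b ∨ B = Set.Ioo a b ∨ B = Set.Ico a b ∨ B = Set.Ioc a b)}

end

end HeightMeasure

/-! A rational of height at most `t` is a coprime pair `(m, n)` in `box ⌊t⌋₊`, so the existence of
`μ(B)` is a question of counting coprime pairs. Möbius inversion over the common divisor `d` reduces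
it to counting all pairs in sets pulled back along multiplication by `d`, and dominated convergence
allows the limit to be taken termwise (`HasBoxDensity.gcd_eq_one`). At a finite place these sets are
periodic modulo a power of `p` (`padicPairs_periodic`); at infinity they are the lattice points of a
convex sector (`hasBoxDensity_sectorPairs`).

The set function `μ*` is Mathlib's `OuterMeasure.mkMetric'` applied to `μ` on balls (`muStar_eq`), a
metric outer measure, so Carathéodory's theory gives σ-additivity and the measurability of Borel
sets. What remains is `μ*(B) = μ(B)`. For `≤`, a ball is cut into finitely many small balls with
total measure at most `μ(B)`. For `≥`, p-adic balls are compact and open, so a countable cover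
reduces to a finite one and finite subadditivity suffices; on the real line, `μ` agrees on balls
with a genuine measure, `ratioMeasure`. -/

namespace HeightMeasure

/-! ### Counting coprime pairs by Möbius inversion. -/

open ArithmeticFunction in
theorem sum_moebius_filter_dvd {g T : ℕ} (hg : 0 < g) (hgT : g ≤ T) :
    ∑ d ∈ Finset.Icc 1 T, (if d ∣ g then moebius d else 0) = if g = 1 then 1 else 0 := by
  rw [← Finset.sum_filter]
  have : (Finset.Icc 1 T).filter (· ∣ g) = g.divisors := by
    ext d
    simp only [Finset.mem_filter, Finset.mem_Icc, Nat.mem_divisors]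
    constructor
    · rintro ⟨-, h⟩; exact ⟨h, hg.ne'⟩
    · rintro ⟨h, -⟩
      exact ⟨⟨Nat.pos_of_dvd_of_pos h hg, (Nat.le_of_dvd hg h).trans hgT⟩, h⟩
  rw [this, ← coe_mul_zeta_apply, moebius_mul_coe_zeta, one_apply]

/-- The pairs of integers `(m, n)` with `|m| ≤ T` and `1 ≤ n ≤ T`. -/
noncomputable def box (T : ℕ) : Finset (ℤ × ℤ) := Finset.Icc (-(T : ℤ)) T ×ˢ Finset.Icc 1 (T : ℤ)

theorem mem_box {T : ℕ} {z : ℤ × ℤ} :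
    z ∈ box T ↔ (-(T : ℤ) ≤ z.1 ∧ z.1 ≤ T) ∧ 1 ≤ z.2 ∧ z.2 ≤ T := by
  simp [box]

open Classical in
/-- The number of elements of `S` in `box T`. -/
noncomputable def boxCount (S : Set (ℤ × ℤ)) (T : ℕ) : ℕ := ((box T).filter (· ∈ S)).card

open Classical in
theorem boxCount_mono {S S' : Set (ℤ × ℤ)} (h : S ⊆ S') (T : ℕ) :
    boxCount S T ≤ boxCount S' T :=
  Finset.card_le_card (Finset.monotone_filter_right _ fun _ _ hz => h hz)

open Classical in
theorem boxCount_univ (T : ℕ) : boxCount Set.univ T = (2 * T + 1) * T := by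
  simp only [boxCount, Set.mem_univ, Finset.filter_true, box, Finset.card_product, Int.card_Icc]
  congr 1 <;> omega

theorem boxCount_le (S : Set (ℤ × ℤ)) (T : ℕ) : boxCount S T ≤ 3 * T ^ 2 := by
  refine (boxCount_mono (Set.subset_univ S) T).trans ?_
  rw [boxCount_univ]
  rcases Nat.eq_zero_or_pos T with rfl | h
  · simp
  · nlinarith

-- Multiplication by `d` is a bijection from the pairs in `box (T / d)` onto the pairs in `box T`
-- with both coordinates divisible by `d`.
open Classical in
theorem card_filter_dvd (S : Set (ℤ × ℤ)) (T : ℕ) {d : ℕ} (hd : 0 < d) :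
    (((box T).filter (· ∈ S)).filter fun z => d ∣ Int.gcd z.1 z.2).card =
      boxCount {z | ((d : ℤ) * z.1, (d : ℤ) * z.2) ∈ S} (T / d) := by
  have hd' : (0 : ℤ) < d := by exact_mod_cast hd
  symm
  refine Finset.card_bij (fun z _ => ((d : ℤ) * z.1, (d : ℤ) * z.2)) ?_ ?_ ?_
  · intro z hz
    simp only [Finset.mem_filter, mem_box, Set.mem_ofPred_eq, Int.natCast_ediv] at hz ⊢
    obtain ⟨⟨⟨h1, h2⟩, h3, h4⟩, h5⟩ := hz
    have e : (d : ℤ) * (T / d) ≤ T := Int.mul_ediv_self_le hd'.ne'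
    refine ⟨⟨⟨⟨?_, ?_⟩, ?_, ?_⟩, h5⟩, ?_⟩
    · nlinarith
    · nlinarith
    · nlinarith
    · nlinarith
    · exact Int.dvd_gcd (dvd_mul_right _ _) (dvd_mul_right _ _)
  · intro a _ b _ hab
    simp only [Prod.mk.injEq, mul_eq_mul_left_iff, hd'.ne', or_false] at hab
    exact Prod.ext hab.1 hab.2
  · intro z hz
    simp only [Finset.mem_filter, mem_box] at hz
    obtain ⟨⟨⟨⟨h1, h2⟩, h3, h4⟩, h5⟩, h6⟩ := hz
    obtain ⟨a, ha⟩ : (d : ℤ) ∣ z.1 := (Int.natCast_dvd_natCast.2 h6).trans (Int.gcd_dvd_left ..)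
    obtain ⟨b, hb⟩ : (d : ℤ) ∣ z.2 := (Int.natCast_dvd_natCast.2 h6).trans (Int.gcd_dvd_right ..)
    refine ⟨(a, b), ?_, Prod.ext ha.symm hb.symm⟩
    simp only [Finset.mem_filter, mem_box, Set.mem_ofPred_eq, Int.natCast_ediv, ← ha, ← hb]
    refine ⟨⟨⟨?_, ?_⟩, ?_, ?_⟩, h5⟩
    · have : -a ≤ (T : ℤ) / d := (Int.le_ediv_iff_mul_le hd').2 (by nlinarith)
      linarith
    · exact (Int.le_ediv_iff_mul_le hd').2 (by nlinarith)
    · by_contra! h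
      nlinarith
    · exact (Int.le_ediv_iff_mul_le hd').2 (by nlinarith)

open Classical ArithmeticFunction in
theorem boxCount_gcd_eq_one (S : Set (ℤ × ℤ)) (T : ℕ) :
    (boxCount {z | z ∈ S ∧ Int.gcd z.1 z.2 = 1} T : ℤ) = ∑ d ∈ Finset.Icc 1 T,
      moebius d * boxCount {z | ((d : ℤ) * z.1, (d : ℤ) * z.2) ∈ S} (T / d) := by
  have h1 : (boxCount {z | z ∈ S ∧ Int.gcd z.1 z.2 = 1} T : ℤ) =
      ∑ z ∈ (box T).filter (· ∈ S), if Int.gcd z.1 z.2 = 1 then 1 else 0 := by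
    rw [Finset.sum_boole, Finset.filter_filter]
    simp only [boxCount, Set.mem_ofPred_eq]
  have h2 : ∀ z ∈ (box T).filter (· ∈ S), (if Int.gcd z.1 z.2 = 1 then (1 : ℤ) else 0) =
      ∑ d ∈ Finset.Icc 1 T, (if d ∣ Int.gcd z.1 z.2 then moebius d else 0) := by
    intro z hz
    simp only [Finset.mem_filter, mem_box] at hz
    obtain ⟨⟨-, h3, h4⟩, -⟩ := hz
    -- Since `1 ≤ z.2 ≤ T`, the gcd lies between `1` and `T`, so the range of `d` contains all its
    -- divisors.
    have hpos : 0 < Int.gcd z.1 z.2 := Int.gcd_pos_of_ne_zero_right _ (by omega)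
    rw [sum_moebius_filter_dvd hpos]
    have : (Int.gcd z.1 z.2 : ℤ) ≤ z.2 := Int.le_of_dvd (by omega) (Int.gcd_dvd_right ..)
    omega
  rw [h1, Finset.sum_congr rfl h2, Finset.sum_comm]
  refine Finset.sum_congr rfl fun d hd => ?_
  rw [← card_filter_dvd S T (Finset.mem_Icc.1 hd).1, ← Finset.sum_filter, Finset.sum_const,
    nsmul_eq_mul, mul_comm]

/-- `S` has `c T ^ 2 + o(T ^ 2)` elements in `box T`. -/
def HasBoxDensity (S : Set (ℤ × ℤ)) (c : ℝ) : Prop :=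
  Tendsto (fun T : ℕ => (boxCount S T : ℝ) / (T : ℝ) ^ 2) atTop (𝓝 c)

theorem tendsto_natCast_div_div {d : ℕ} :
    Tendsto (fun T : ℕ => ((T / d : ℕ) : ℝ) / T) atTop (𝓝 (d : ℝ)⁻¹) := by
  have := (tendsto_nat_floor_mul_div_atTop (R := ℝ) (a := (d : ℝ)⁻¹) (by positivity)).comp
    tendsto_natCast_atTop_atTop
  refine this.congr fun T => ?_
  simp only [Function.comp]
  rw [inv_mul_eq_div, Nat.floor_div_eq_div]

-- The term for `d` counts pairs in `box (T / d)`, hence is asymptotic to `c d * (T / d) ^ 2`; the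
-- trivial bound `boxCount_le` dominates it by the summable `3 / d ^ 2`, uniformly in `T`.
open ArithmeticFunction in
theorem HasBoxDensity.gcd_eq_one {S : Set (ℤ × ℤ)} {c : ℕ → ℝ}
    (h : ∀ d : ℕ, 0 < d → HasBoxDensity {z | ((d : ℤ) * z.1, (d : ℤ) * z.2) ∈ S} (c d)) :
    HasBoxDensity {z | z ∈ S ∧ Int.gcd z.1 z.2 = 1}
      (∑' d : ℕ, (moebius d : ℝ) * (c d * ((d : ℝ)⁻¹) ^ 2)) := by
  set F : ℕ → ℕ → ℝ := fun T d => (moebius d : ℝ) *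
    ((boxCount {z | ((d : ℤ) * z.1, (d : ℤ) * z.2) ∈ S} (T / d) : ℝ) / (T : ℝ) ^ 2) with hF
  have key : Tendsto (fun T => ∑' d, F T d) atTop
      (𝓝 (∑' d : ℕ, (moebius d : ℝ) * (c d * ((d : ℝ)⁻¹) ^ 2))) := by
    refine tendsto_tsum_of_dominated_convergence (bound := fun d : ℕ => 3 * ((d : ℝ) ^ 2)⁻¹)
      ((Real.summable_nat_pow_inv.2 one_lt_two).mul_left 3) (fun d => ?_) ?_
    · rcases Nat.eq_zero_or_pos d with rfl | hd
      · simp [hF]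
      refine Tendsto.const_mul _ ?_
      have h1 := ((h d hd).comp (Nat.tendsto_div_const_atTop hd.ne')).mul
        ((tendsto_natCast_div_div (d := d)).pow 2)
      refine h1.congr' ?_
      filter_upwards [eventually_ge_atTop d] with T hT
      have : ((T / d : ℕ) : ℝ) ≠ 0 := by
        exact_mod_cast (Nat.div_pos hT hd).ne'
      simp only [Function.comp]
      field_simp
    · filter_upwards [eventually_gt_atTop 0] with T hT d
      have hT' : (0 : ℝ) < T := by exact_mod_cast hT
      have h1 : ‖(moebius d : ℝ)‖ ≤ 1 := by
        rw [Real.norm_eq_abs]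
        exact_mod_cast abs_moebius_le_one
      have h2 : ((boxCount {z | ((d : ℤ) * z.1, (d : ℤ) * z.2) ∈ S} (T / d) : ℝ)) ≤
          3 * ((T : ℝ) / d) ^ 2 := by
        calc _ ≤ ((3 * (T / d) ^ 2 : ℕ) : ℝ) := by exact_mod_cast boxCount_le _ _
          _ ≤ _ := by
            push_cast
            gcongr
            exact Nat.cast_div_le
      simp only [hF]
      rw [norm_mul, ← one_mul (3 * _)]
      refine mul_le_mul h1 ?_ (norm_nonneg _) zero_le_one
      rw [Real.norm_of_nonneg (by positivity), div_le_iff₀ (by positivity)]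
      refine h2.trans (le_of_eq ?_)
      rw [div_pow]
      ring
  refine key.congr fun T => ?_
  -- Terms with `d > T` vanish because `T / d = 0` and the box is empty; for `d = 0` the Möbius
  -- function is zero.
  rw [tsum_eq_sum (s := Finset.Icc 1 T)]
  · have := congrArg (fun k : ℤ => (k : ℝ)) (boxCount_gcd_eq_one S T)
    push_cast at this
    rw [this, Finset.sum_div]
    exact Finset.sum_congr rfl fun d _ => by simp only [hF]; ring
  · intro d hd
    rcases Nat.eq_zero_or_pos d with rfl | hd0
    · simp [hF]
    have : T / d = 0 := Nat.div_eq_of_lt (by simp at hd; omega)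
    have h0 := boxCount_le {z | ((d : ℤ) * z.1, (d : ℤ) * z.2) ∈ S} 0
    simp only [hF, this]
    simp at h0
    simp [h0]

theorem HasBoxDensity.univ : HasBoxDensity Set.univ 2 := by
  have h : Tendsto (fun T : ℕ => (2 : ℝ) + ((T : ℝ))⁻¹) atTop (𝓝 (2 + 0)) :=
    tendsto_const_nhds.add tendsto_inv_atTop_nhds_zero_nat
  rw [add_zero] at h
  refine h.congr' ?_
  filter_upwards [eventually_gt_atTop 0] with T hT
  have : (T : ℝ) ≠ 0 := by exact_mod_cast hT.ne'
  rw [boxCount_univ]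
  push_cast
  field_simp

-- The sum is the L-series of `moebius` at `2`, whose product with the L-series of zeta is `1`.
open ArithmeticFunction LSeries.notation in
theorem tsum_moebius_mul_inv_sq_ne_zero :
    ∑' d : ℕ, (moebius d : ℝ) * ((d : ℝ)⁻¹) ^ 2 ≠ 0 := by
  intro h
  have h1 := LSeries_zeta_mul_Lseries_moebius (s := 2) (by norm_num)
  have h2 : L ↗moebius 2 = ((∑' d : ℕ, (moebius d : ℝ) * ((d : ℝ)⁻¹) ^ 2 : ℝ) : ℂ) := by
    rw [Complex.ofReal_tsum, LSeries]
    refine tsum_congr fun d => ?_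
    rcases Nat.eq_zero_or_pos d with rfl | hd
    · simp
    rw [LSeries.term_of_ne_zero hd.ne']
    rw [show (2 : ℂ) = ((2 : ℕ) : ℂ) by norm_num, Complex.cpow_natCast]
    push_cast
    rw [inv_pow, div_eq_mul_inv]
  rw [h2, h] at h1
  simp at h1

/-! ### From densities of pairs to proportions of rationals. -/

/-- Rationals correspond to coprime pairs with positive second entry. Only the reduced pairs of `S`
are prescribed; the freedom on the other pairs is what permits a periodic choice of `S` at a finite
place. -/
theorem ncard_height_le (V : Set ℚ) {S : Set (ℤ × ℤ)}
    (h : ∀ r : ℚ, (r.num, (r.den : ℤ)) ∈ S ↔ r ∈ V) {t : ℝ} (ht : 0 ≤ t) :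
    Set.ncard {r : ℚ | r ∈ V ∧ (height r : ℝ) ≤ t} =
      boxCount {z | z ∈ S ∧ Int.gcd z.1 z.2 = 1} ⌊t⌋₊ := by
  classical
  have hinj : Function.Injective fun r : ℚ => (r.num, (r.den : ℤ)) := by
    intro a b hab
    simp only [Prod.mk.injEq, Nat.cast_inj] at hab
    exact Rat.ext hab.1 hab.2
  rw [← Set.ncard_image_of_injective _ hinj, boxCount, ← Set.ncard_coe_finset]
  congr 1
  ext ⟨m, n⟩
  simp only [Set.mem_image, Set.mem_ofPred_eq, Finset.coe_filter, mem_box, Prod.mk.injEq]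
  constructor
  · rintro ⟨r, ⟨hr, hht⟩, rfl, rfl⟩
    have h1 : max r.num.natAbs r.den ≤ ⌊t⌋₊ := Nat.le_floor hht
    have h2 := r.den_pos
    exact ⟨by omega, (h r).2 hr, r.reduced⟩
  · rintro ⟨hb, hS, hg⟩
    have h1 : (m / n : ℚ).num = m := Rat.num_div_eq_of_coprime (by omega) hg
    have h2 : ((m / n : ℚ).den : ℤ) = n := Rat.den_div_eq_of_coprime (by omega) hg
    refine ⟨m / n, ⟨(h _).1 (by rwa [h1, h2]), ?_⟩, h1, h2⟩
    refine (Nat.le_floor_iff ht).1 ?_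
    unfold height
    omega

variable {K : Type*} [NormedField K]

open ArithmeticFunction in
theorem tendsto_proportion {U : Set K} {S : Set (ℤ × ℤ)} {c : ℕ → ℝ}
    (h : ∀ r : ℚ, (r.num, (r.den : ℤ)) ∈ S ↔ (r : K) ∈ closure U)
    (hS : ∀ d : ℕ, 0 < d → HasBoxDensity {z | ((d : ℤ) * z.1, (d : ℤ) * z.2) ∈ S} (c d)) :
    Tendsto (proportion U) atTop
      (𝓝 ((∑' d : ℕ, (moebius d : ℝ) * (c d * ((d : ℝ)⁻¹) ^ 2)) /
        (∑' d : ℕ, (moebius d : ℝ) * (2 * ((d : ℝ)⁻¹) ^ 2)))) := by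
  have h1 := HasBoxDensity.gcd_eq_one hS
  have h2 := HasBoxDensity.gcd_eq_one (S := Set.univ) (c := fun _ => 2)
    (fun d _ => by simpa using HasBoxDensity.univ)
  have h3 : ∑' d : ℕ, (moebius d : ℝ) * (2 * ((d : ℝ)⁻¹) ^ 2) ≠ 0 := by
    simp_rw [mul_left_comm _ (2 : ℝ), tsum_mul_left]
    exact mul_ne_zero two_ne_zero tsum_moebius_mul_inv_sq_ne_zero
  refine ((h1.div h2 h3).comp (tendsto_nat_floor_atTop (α := ℝ))).congr' ?_
  filter_upwards [eventually_ge_atTop 1] with t ht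
  have hT : ((⌊t⌋₊ : ℕ) : ℝ) ≠ 0 := by exact_mod_cast (Nat.floor_pos.2 ht).ne'
  have e1 := ncard_height_le {r : ℚ | (r : K) ∈ closure U} h (zero_le_one.trans ht)
  have e2 := ncard_height_le Set.univ (S := Set.univ) (by simp) (zero_le_one.trans ht)
  simp only [Set.mem_ofPred_eq] at e1
  simp only [Set.mem_univ, true_and] at e2
  simp only [proportion, e1, e2, Function.comp, Pi.div_apply, Set.mem_univ, true_and]
  rw [div_div_div_cancel_right₀ (pow_ne_zero 2 hT)]

-- When `S` is invariant under scaling, the density does not depend on `d`, and the same Möbius sum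
-- cancels from numerator and denominator.
open ArithmeticFunction in
theorem tendsto_proportion_of_scaling {U : Set K} {S : Set (ℤ × ℤ)} {c : ℝ}
    (h : ∀ r : ℚ, (r.num, (r.den : ℤ)) ∈ S ↔ (r : K) ∈ closure U)
    (hscale : ∀ d : ℕ, 0 < d → ∀ z : ℤ × ℤ, ((d : ℤ) * z.1, (d : ℤ) * z.2) ∈ S ↔ z ∈ S)
    (hS : HasBoxDensity S c) : Tendsto (proportion U) atTop (𝓝 (c / 2)) := by
  have := tendsto_proportion (c := fun _ => c) h fun d hd => by
    have e : {z : ℤ × ℤ | ((d : ℤ) * z.1, (d : ℤ) * z.2) ∈ S} = S := Set.ext (hscale d hd)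
    rwa [e]
  simp_rw [mul_left_comm _ c, mul_left_comm _ (2 : ℝ), tsum_mul_left] at this
  rwa [mul_div_mul_right _ _ tsum_moebius_mul_inv_sq_ne_zero] at this

/-! ### The height measure as a limit, and `muStar` as a metric outer measure. -/

theorem heightMeasure_eq {U : Set K} {l : ℝ} (h : Tendsto (proportion U) atTop (𝓝 l)) :
    heightMeasure U = ENNReal.ofReal l := by
  rw [heightMeasure, h.limUnder_eq]

theorem HeightMeasurable.tendsto {U : Set K} (h : HeightMeasurable U) :
    Tendsto (proportion U) atTop (𝓝 (limUnder atTop (proportion U))) :=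
  tendsto_nhds_limUnder h

theorem proportion_nonneg (U : Set K) (t : ℝ) : 0 ≤ proportion U t := by
  unfold proportion
  positivity

theorem HeightMeasurable.tendsto_ofReal {U : Set K} (h : HeightMeasurable U) :
    Tendsto (fun t => ENNReal.ofReal (proportion U t)) atTop (𝓝 (heightMeasure U)) :=
  (ENNReal.continuous_ofReal.tendsto _).comp h.tendsto

/-- The set function which is `heightMeasure` on `balls` and `∞` elsewhere. -/
noncomputable def ballMeasure (balls : Set (Set K)) (s : Set K) : ℝ≥0∞ :=
  ⨅ _ : s ∈ balls, heightMeasure s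

theorem muDelta_eq {balls : Set (Set K)} (δ : ℝ) (E : Set K) :
    muDelta balls δ E =
      OuterMeasure.mkMetric'.pre (ballMeasure balls) (ENNReal.ofReal δ) E := by
  classical
  rw [OuterMeasure.mkMetric'.pre, OuterMeasure.boundedBy_apply]
  apply le_antisymm
  -- Empty members of a cover are discarded; if some nonempty member is not a ball or is too large,
  -- the sum is `∞`.
  · refine le_iInf₂ fun t ht => ?_
    set I : Set ℕ := {n | (t n).Nonempty} with hI
    by_cases hgood : ∀ i ∈ I, t i ∈ balls ∧ Metric.ediam (t i) ≤ ENNReal.ofReal δ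
    · refine iInf_le_of_le I <| iInf_le_of_le t <| iInf_le_of_le hgood <| iInf_le_of_le ?_ ?_
      · intro x hx
        obtain ⟨i, hi⟩ := Set.mem_iUnion.1 (ht hx)
        exact Set.mem_iUnion₂.2 ⟨i, ⟨x, hi⟩, hi⟩
      · rw [tsum_subtype I fun i => heightMeasure (t i)]
        refine ENNReal.tsum_le_tsum fun i => ?_
        by_cases hi : i ∈ I
        · have hi' : (t i).Nonempty := hi
          simp [hi, extend, ballMeasure, hgood i hi, hi']
        · simp [hi]
    · push Not at hgood
      obtain ⟨i, hi, hbad⟩ := hgood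
      refine le_trans le_top (le_trans (le_of_eq ?_) (ENNReal.le_tsum i))
      have hi' : (t i).Nonempty := hi
      by_cases hb : t i ∈ balls
      · simp [extend, hi', (hbad hb).not_ge]
      · simp [extend, hi', ballMeasure, hb]
  · unfold muDelta
    refine le_iInf fun I => le_iInf fun B => le_iInf₂ fun hB hE => ?_
    -- Unused indices are filled with the empty set, which costs nothing in `boundedBy`.
    refine iInf₂_le_of_le (fun i => if i ∈ I then B i else ∅) ?_ ?_
    · intro x hx
      obtain ⟨i, hi, hxi⟩ := Set.mem_iUnion₂.1 (hE hx)
      exact Set.mem_iUnion.2 ⟨i, by simpa [hi] using hxi⟩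
    · rw [tsum_subtype I fun i => heightMeasure (B i)]
      refine ENNReal.tsum_le_tsum fun i => ?_
      by_cases hi : i ∈ I
      · simp [hi, extend, ballMeasure, hB i hi]
      · simp [hi]

theorem muStar_eq {balls : Set (Set K)} (E : Set K) :
    muStar balls E = OuterMeasure.mkMetric' (ballMeasure balls) E := by
  simp only [muStar, OuterMeasure.mkMetric', OuterMeasure.iSup_apply, muDelta_eq]
  apply le_antisymm
  · exact iSup₂_le fun δ hδ => le_iSup₂_of_le (ENNReal.ofReal δ) (ENNReal.ofReal_pos.2 hδ) le_rfl
  · refine iSup₂_le fun r hr => ?_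
    -- The bound `r` may be `∞`; a smaller finite bound only increases the value.
    obtain ⟨q, hq0, hq⟩ := ENNReal.lt_iff_exists_nnreal_btwn.1 (show (0 : ℝ≥0∞) < r from hr)
    refine le_iSup₂_of_le (q : ℝ) (by exact_mod_cast hq0) ?_
    rw [ENNReal.ofReal_coe_nnreal]
    exact OuterMeasure.mkMetric'.mono_pre _ hq.le E

/-- If `heightMeasure` is compatible with covers of balls by small balls, then `muStar` is a metric
outer measure which extends it. -/
theorem exists_outerMeasure {balls : Set (Set K)}
    (hmeas : ∀ B ∈ balls, HeightMeasurable B)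
    (hlower : ∀ B ∈ balls, heightMeasure B ≤ muStar balls B)
    (hupper : ∀ B ∈ balls, ∀ δ : ℝ, 0 < δ →
      OuterMeasure.mkMetric'.pre (ballMeasure balls) (ENNReal.ofReal δ) B ≤ heightMeasure B) :
    ∃ ν : OuterMeasure K, (∀ E : Set K, ν E = muStar balls E) ∧
      (∀ A : ℕ → Set K, (∀ n, ν.IsCaratheodory (A n)) →
        Pairwise (Function.onFun Disjoint A) → ν (⋃ n, A n) = ∑' n, ν (A n)) ∧
      (∀ A : Set K, MeasurableSet[borel K] A → ν.IsCaratheodory A) ∧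
      (∀ B ∈ balls, HeightMeasurable B ∧ ν B = heightMeasure B) := by
  refine ⟨OuterMeasure.mkMetric' (ballMeasure balls), fun E => (muStar_eq E).symm,
    fun A hA hd => OuterMeasure.f_iUnion _ hA hd,
    fun A hA => (OuterMeasure.mkMetric'_isMetric _).borel_le_caratheodory A hA,
    fun B hB => ⟨hmeas B hB, le_antisymm ?_ ?_⟩⟩
  · rw [← muStar_eq, muStar]
    exact iSup₂_le fun δ hδ => (muDelta_eq δ B).trans_le (hupper B hB δ hδ)
  · rw [← muStar_eq]
    exact hlower B hB

/-! ### Finite subadditivity and superadditivity of the height measure. -/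

section FiniteAdditivity

variable {K : Type*} [NormedField K]

open Classical in
theorem proportion_eq_card_div (U : Set K) (t : ℝ) :
    proportion U t =
      (((finite_height_le t).toFinset.filter fun r : ℚ => (r : K) ∈ closure U).card : ℝ) /
        (finite_height_le t).toFinset.card := by
  rw [proportion, ← Set.ncard_coe_finset, ← Set.ncard_coe_finset]
  congr 3
  · ext r
    simp [and_comm]
  · simp

/-- The inequality holds between the proportions for each `t`, by a union bound, and passes to the
limit because the sum is finite. -/
theorem heightMeasure_le_sum {ι : Type*} {F : Finset ι} {B : Set K} {C : ι → Set K}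
    (hB : HeightMeasurable B) (hC : ∀ i ∈ F, HeightMeasurable (C i))
    (h : closure B ⊆ ⋃ i ∈ F, closure (C i)) :
    heightMeasure B ≤ ∑ i ∈ F, heightMeasure (C i) := by
  classical
  refine le_of_tendsto_of_tendsto hB.tendsto_ofReal
    (tendsto_finsetSum F fun i hi => (hC i hi).tendsto_ofReal) (Eventually.of_forall fun t => ?_)
  simp only
  rw [← ENNReal.ofReal_sum_of_nonneg fun i _ => proportion_nonneg _ _]
  refine ENNReal.ofReal_le_ofReal ?_
  simp only [proportion_eq_card_div, ← Finset.sum_div]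
  refine div_le_div_of_nonneg_right ?_ (Nat.cast_nonneg _)
  rw [← Nat.cast_sum, Nat.cast_le]
  refine (Finset.card_le_card fun r hr => ?_).trans Finset.card_biUnion_le
  rw [Finset.mem_filter] at hr
  obtain ⟨i, hi, hri⟩ := Set.mem_iUnion₂.1 (h hr.2)
  exact Finset.mem_biUnion.2 ⟨i, hi, Finset.mem_filter.2 ⟨hr.1, hri⟩⟩

theorem sum_le_heightMeasure {ι : Type*} {F : Finset ι} {B : Set K} {C : ι → Set K}
    (hB : HeightMeasurable B) (hC : ∀ i ∈ F, HeightMeasurable (C i))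
    (hsub : ∀ i ∈ F, closure (C i) ⊆ closure B)
    (hd : (F : Set ι).PairwiseDisjoint fun i => closure (C i)) :
    ∑ i ∈ F, heightMeasure (C i) ≤ heightMeasure B := by
  classical
  refine le_of_tendsto_of_tendsto (tendsto_finsetSum F fun i hi => (hC i hi).tendsto_ofReal)
    hB.tendsto_ofReal (Eventually.of_forall fun t => ?_)
  simp only
  rw [← ENNReal.ofReal_sum_of_nonneg fun i _ => proportion_nonneg _ _]
  refine ENNReal.ofReal_le_ofReal ?_
  simp only [proportion_eq_card_div, ← Finset.sum_div]
  refine div_le_div_of_nonneg_right ?_ (Nat.cast_nonneg _)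
  rw [← Nat.cast_sum, Nat.cast_le, ← Finset.card_biUnion]
  · refine Finset.card_le_card fun r hr => ?_
    obtain ⟨i, hi, hri⟩ := Finset.mem_biUnion.1 hr
    rw [Finset.mem_filter] at hri
    exact Finset.mem_filter.2 ⟨hri.1, hsub i hi hri.2⟩
  · intro i hi j hj hij
    refine Finset.disjoint_left.2 fun r hri hrj => ?_
    exact Set.disjoint_left.1 (hd hi hj hij) (Finset.mem_filter.1 hri).2 (Finset.mem_filter.1 hrj).2

end FiniteAdditivity

/-! ### Densities of periodic sets of pairs. -/

section Periodic

/-- The count is a difference of two floors, each with an error in `[0, 1)`. -/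
theorem abs_card_Ioc_filter_modEq_sub_le {u w r : ℤ} (hr : 0 < r) (huw : u ≤ w) (v : ℤ) :
    |(((Finset.Ioc u w).filter (· ≡ v [ZMOD r])).card : ℝ) - (w - u : ℝ) / r| ≤ 1 := by
  have hr' : (0 : ℚ) < r := by exact_mod_cast hr
  have h := Int.Ioc_filter_modEq_card u w hr v
  have hle : ⌊((u : ℚ) - v) / r⌋ ≤ ⌊((w : ℚ) - v) / r⌋ := by
    apply Int.floor_mono
    gcongr
  rw [max_eq_left (by omega)] at h
  have h' := congrArg (fun k : ℤ => (k : ℚ)) h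
  push_cast at h'
  have key : |(((Finset.Ioc u w).filter (· ≡ v [ZMOD r])).card : ℚ) - (w - u : ℚ) / r| ≤ 1 := by
    rw [h', show ((w : ℚ) - u) / r = (w - v) / r - (u - v) / r by ring]
    have a1 := Int.floor_le (((u : ℚ) - v) / r)
    have a2 := Int.lt_floor_add_one (((u : ℚ) - v) / r)
    have a3 := Int.floor_le (((w : ℚ) - v) / r)
    have a4 := Int.lt_floor_add_one (((w : ℚ) - v) / r)
    rw [abs_le]
    constructor <;> linarith
  exact_mod_cast key

theorem tendsto_card_Ioc_filter_modEq_div {u w : ℕ → ℤ} {r : ℤ} (hr : 0 < r)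
    (huw : ∀ T, u T ≤ w T) (v : ℤ) {L : ℝ}
    (hL : Tendsto (fun T : ℕ => ((w T : ℝ) - u T) / T) atTop (𝓝 L)) :
    Tendsto (fun T : ℕ => (((Finset.Ioc (u T) (w T)).filter (· ≡ v [ZMOD r])).card : ℝ) / T) atTop
      (𝓝 (L / r)) := by
  have h1 : Tendsto (fun T : ℕ =>
      ((((Finset.Ioc (u T) (w T)).filter (· ≡ v [ZMOD r])).card : ℝ) - (w T - u T : ℝ) / r) / T)
      atTop (𝓝 0) := by
    refine squeeze_zero_norm (fun T => ?_) (tendsto_inv_atTop_nhds_zero_nat (𝕜 := ℝ))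
    rw [norm_div, Real.norm_natCast, div_eq_mul_inv]
    exact mul_le_of_le_one_left (by positivity)
      (abs_card_Ioc_filter_modEq_sub_le hr (huw T) v)
  have h2 := h1.add (hL.div_const (r : ℝ))
  rw [zero_add] at h2
  exact h2.congr fun T => by ring

-- A periodic set is a finite union of residue classes modulo `N`, each a product of two arithmetic
-- progressions, whose counts are linear in `T` up to a bounded error.
open Classical in
theorem exists_hasBoxDensity_of_periodic {S : Set (ℤ × ℤ)} {N : ℕ} (hN : 0 < N)
    (h : ∀ z z' : ℤ × ℤ, z.1 ≡ z'.1 [ZMOD N] → z.2 ≡ z'.2 [ZMOD N] → z ∈ S → z' ∈ S) :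
    ∃ c, HasBoxDensity S c := by
  have hN' : (0 : ℤ) < N := by exact_mod_cast hN
  set R : Finset (ℤ × ℤ) := Finset.Ico 0 (N : ℤ) ×ˢ Finset.Ico 0 (N : ℤ) with hR
  have hcount : ∀ T, boxCount S T = ∑ z ∈ R.filter (· ∈ S),
      ((Finset.Ioc (-(T : ℤ) - 1) T).filter (· ≡ z.1 [ZMOD N])).card *
        ((Finset.Ioc 0 (T : ℤ)).filter (· ≡ z.2 [ZMOD N])).card := by
    intro T
    rw [boxCount, Finset.card_eq_sum_card_fiberwise (t := R.filter (· ∈ S))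
      (f := fun z : ℤ × ℤ => (z.1 % N, z.2 % N))]
    · refine Finset.sum_congr rfl fun z hz => ?_
      rw [← Finset.card_product]
      congr 1
      ext ⟨m, n⟩
      obtain ⟨a, b⟩ := z
      simp only [hR, Finset.mem_filter, Finset.mem_product, Finset.mem_Ico, Finset.mem_Ioc,
        mem_box, Prod.mk.injEq] at hz ⊢
      obtain ⟨⟨⟨ha0, ha⟩, hb0, hb⟩, hS⟩ := hz
      have ea : m ≡ a [ZMOD N] ↔ m % N = a := by rw [Int.ModEq, Int.emod_eq_of_lt ha0 ha]
      have eb : n ≡ b [ZMOD N] ↔ n % N = b := by rw [Int.ModEq, Int.emod_eq_of_lt hb0 hb]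
      rw [← ea, ← eb]
      constructor
      · rintro ⟨⟨hb, -⟩, hma, hnb⟩
        exact ⟨⟨by omega, hma⟩, by omega, hnb⟩
      · rintro ⟨⟨h1, hma⟩, h2, hnb⟩
        exact ⟨⟨by omega, h _ _ hma.symm hnb.symm hS⟩, hma, hnb⟩
    · intro z hz
      simp only [hR, Finset.coe_filter, Finset.mem_product, Finset.mem_Ico,
        Set.mem_ofPred_eq] at hz ⊢
      refine ⟨⟨⟨Int.emod_nonneg _ hN'.ne', Int.emod_lt_of_pos _ hN'⟩,
        Int.emod_nonneg _ hN'.ne', Int.emod_lt_of_pos _ hN'⟩,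
        h _ _ (Int.mod_modEq _ _).symm (Int.mod_modEq _ _).symm hz.2⟩
  have l1 : Tendsto (fun T : ℕ => (((T : ℤ) : ℝ) - ((-(T : ℤ) - 1 : ℤ) : ℝ)) / T) atTop (𝓝 2) := by
    have : Tendsto (fun T : ℕ => (2 : ℝ) + ((T : ℝ))⁻¹) atTop (𝓝 (2 + 0)) :=
      tendsto_const_nhds.add tendsto_inv_atTop_nhds_zero_nat
    rw [add_zero] at this
    refine this.congr' ?_
    filter_upwards [eventually_gt_atTop 0] with T hT
    have : (T : ℝ) ≠ 0 := by exact_mod_cast hT.ne'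
    push_cast
    field_simp
    ring
  have l2 : Tendsto (fun T : ℕ => (((T : ℤ) : ℝ) - ((0 : ℤ) : ℝ)) / T) atTop (𝓝 1) := by
    refine (tendsto_const_nhds (x := (1 : ℝ))).congr' ?_
    filter_upwards [eventually_gt_atTop 0] with T hT
    have : (T : ℝ) ≠ 0 := by exact_mod_cast hT.ne'
    push_cast
    field_simp
    ring
  refine ⟨_, (tendsto_finsetSum (R.filter (· ∈ S)) fun z _ =>
    (tendsto_card_Ioc_filter_modEq_div hN' (fun T => by omega) z.1 l1).mul
      (tendsto_card_Ioc_filter_modEq_div hN' (fun T => by omega) z.2 l2)).congr fun T => ?_⟩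
  rw [hcount]
  push_cast
  rw [Finset.sum_div]
  exact Finset.sum_congr rfl fun z _ => by ring

end Periodic

/-! ### The finite places. -/

section Padic

theorem norm_sub_le_max_of_ultra {G : Type*} [SeminormedAddGroup G] [IsUltrametricDist G]
    (x y : G) : ‖x - y‖ ≤ max ‖x‖ ‖y‖ := by
  simpa [sub_eq_add_neg] using IsUltrametricDist.norm_add_le_max x (-y)

variable {p : ℕ} [Fact p.Prime]

/-- The pairs `(m, n)`, not both divisible by `p`, with `‖x - m / n‖ ≤ C`. -/
def padicPairs (x : ℚ_[p]) (C : ℝ) : Set (ℤ × ℤ) :=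
  {z | ¬((p : ℤ) ∣ z.1 ∧ (p : ℤ) ∣ z.2) ∧
    ‖x * (z.2 : ℚ_[p]) - (z.1 : ℚ_[p])‖ ≤ C * ‖(z.2 : ℚ_[p])‖}

/-- As `m` and `n` are not both divisible by `p`, the inequality keeps `‖n‖` away from `0`: for
small `‖n‖` it would force `‖m‖ < 1` as well. A perturbation of `m` and `n` by multiples of a high
power of `p` then preserves `‖n‖` and the inequality. -/
theorem padicPairs_periodic (x : ℚ_[p]) {C : ℝ} (hC : 0 < C) :
    ∃ N : ℕ, 0 < N ∧ ∀ z z' : ℤ × ℤ, z.1 ≡ z'.1 [ZMOD N] → z.2 ≡ z'.2 [ZMOD N] →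
      z ∈ padicPairs x C → z' ∈ padicPairs x C := by
  have hp : p.Prime := Fact.out
  have hx := norm_nonneg x
  set ε : ℝ := (‖x‖ + C + 1)⁻¹ with hε
  have hε0 : 0 < ε := by positivity
  have hmul : (‖x‖ + C + 1) * ε = 1 := mul_inv_cancel₀ (by positivity)
  have hlarge : ∀ z ∈ padicPairs x C, ε < ‖(z.2 : ℚ_[p])‖ := by
    rintro ⟨m, n⟩ ⟨hdiv, hle⟩
    by_contra! hn
    simp only at hdiv hle hn
    have hn1 : ‖(n : ℚ_[p])‖ < 1 := by nlinarith
    have hm1 : ‖(m : ℚ_[p])‖ = 1 := by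
      refine le_antisymm (Padic.norm_int_le_one m) (not_lt.1 fun hm => hdiv ?_)
      exact ⟨Padic.norm_intCast_lt_one_iff.1 hm, Padic.norm_intCast_lt_one_iff.1 hn1⟩
    have hxn : ‖x * (n : ℚ_[p])‖ < 1 := by
      rw [norm_mul]
      nlinarith [mul_le_mul_of_nonneg_left hn hx]
    have h1 : ‖(m : ℚ_[p])‖ ≤ max ‖x * (n : ℚ_[p])‖ ‖x * (n : ℚ_[p]) - m‖ := by
      have := norm_sub_le_max_of_ultra (x * (n : ℚ_[p])) (x * (n : ℚ_[p]) - m)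
      rwa [sub_sub_cancel] at this
    have h2 : C * ‖(n : ℚ_[p])‖ < 1 := by nlinarith [mul_le_mul_of_nonneg_left hn hC.le]
    rw [hm1] at h1
    exact absurd h1 (not_le.2 (max_lt hxn (hle.trans_lt h2)))
  -- The first bound keeps `‖n‖` unchanged and forces `k ≠ 0`; the second keeps the change of `x * n
  -- - m` below `C * ε`.
  have hη : 0 < min (ε / 2) (C * ε / (‖x‖ + 1)) := by positivity
  obtain ⟨k, hk⟩ := exists_pow_lt_of_lt_one hη
    (inv_lt_one_of_one_lt₀ (show (1 : ℝ) < p by exact_mod_cast hp.one_lt))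
  obtain ⟨hk1, hk2⟩ := lt_min_iff.1 hk
  have hε1 : ε < 1 := by nlinarith
  have hk0 : k ≠ 0 := by
    rintro rfl
    rw [pow_zero] at hk1
    linarith
  refine ⟨p ^ k, pow_pos hp.pos k, ?_⟩
  have hdvd : ∀ a b : ℤ, a ≡ b [ZMOD (p ^ k : ℕ)] →
      ‖(b : ℚ_[p]) - a‖ ≤ (p : ℝ)⁻¹ ^ k ∧ ((p : ℤ) ∣ a ↔ (p : ℤ) ∣ b) := by
    intro a b hab
    have h1 : ((p ^ k : ℕ) : ℤ) ∣ b - a := hab.dvd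
    constructor
    · have := (Padic.norm_int_le_pow_iff_dvd (p := p) (b - a) k).2 (by exact_mod_cast h1)
      rw [zpow_neg, zpow_natCast, ← inv_pow] at this
      exact_mod_cast this
    · have h2 : (p : ℤ) ∣ b - a :=
        (by exact_mod_cast dvd_pow_self p hk0 : (p : ℤ) ∣ (p ^ k : ℕ)).trans h1
      exact dvd_iff_dvd_of_dvd_sub (dvd_sub_comm.1 h2)
  rintro ⟨m, n⟩ ⟨m', n'⟩ hm hn hz
  have hn0 := hlarge _ hz
  obtain ⟨hdiv, hle⟩ := hz
  simp only at hm hn hn0 hdiv hle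
  obtain ⟨hm1, hm2⟩ := hdvd _ _ hm
  obtain ⟨hn1, hn2⟩ := hdvd _ _ hn
  have hnn : ‖(n' : ℚ_[p])‖ = ‖(n : ℚ_[p])‖ := by
    have h1 : ‖(n' : ℚ_[p]) - n‖ < ‖(n : ℚ_[p])‖ := by linarith
    have := IsUltrametricDist.norm_add_eq_max_of_norm_ne_norm h1.ne
    rwa [sub_add_cancel, max_eq_right h1.le] at this
  refine ⟨by rwa [← hm2, ← hn2], ?_⟩
  simp only
  rw [hnn]
  have hCn : C * ε ≤ C * ‖(n : ℚ_[p])‖ := by gcongr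
  have hq : (p : ℝ)⁻¹ ^ k * (‖x‖ + 1) < C * ε := by rwa [lt_div_iff₀ (by positivity)] at hk2
  have hpk : (0 : ℝ) ≤ (p : ℝ)⁻¹ ^ k := by positivity
  have e : x * (n' : ℚ_[p]) - m' = (x * n - m) + (x * (n' - n) - (m' - m)) := by ring
  rw [e]
  refine (IsUltrametricDist.norm_add_le_max _ _).trans (max_le hle ?_)
  refine (norm_sub_le_max_of_ultra _ _).trans (max_le ?_ ?_)
  · rw [norm_mul]
    nlinarith [mul_le_mul_of_nonneg_left hn1 hx]
  · nlinarith

theorem padicBall_eq_closedBall (x : ℚ_[p]) (e : ℤ) :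
    {r | ‖x - r‖ ≤ (p : ℝ) ^ (-e)} = Metric.closedBall x ((p : ℝ) ^ (-e)) := by
  ext r
  rw [Metric.mem_closedBall', dist_eq_norm]
  rfl

theorem exists_closedBall_of_mem_padicBalls {B : Set ℚ_[p]} (hB : B ∈ padicBalls p) :
    ∃ (x : ℚ_[p]) (e : ℤ), B = Metric.closedBall x ((p : ℝ) ^ (-e)) := by
  obtain ⟨x, e, rfl⟩ := hB
  exact ⟨x, e, padicBall_eq_closedBall x e⟩

theorem closedBall_mem_padicBalls (x : ℚ_[p]) (e : ℤ) :
    Metric.closedBall x ((p : ℝ) ^ (-e)) ∈ padicBalls p :=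
  ⟨x, e, (padicBall_eq_closedBall x e).symm⟩

theorem isClosed_of_mem_padicBalls {B : Set ℚ_[p]} (hB : B ∈ padicBalls p) : IsClosed B := by
  obtain ⟨x, e, rfl⟩ := exists_closedBall_of_mem_padicBalls hB
  exact Metric.isClosed_closedBall

theorem padic_zpow_pos (e : ℤ) : (0 : ℝ) < (p : ℝ) ^ e :=
  zpow_pos (by exact_mod_cast (Fact.out : p.Prime).pos) e

theorem isOpen_of_mem_padicBalls {B : Set ℚ_[p]} (hB : B ∈ padicBalls p) : IsOpen B := by
  obtain ⟨x, e, rfl⟩ := exists_closedBall_of_mem_padicBalls hB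
  exact IsUltrametricDist.isOpen_closedBall x (padic_zpow_pos _).ne'

theorem isCompact_of_mem_padicBalls {B : Set ℚ_[p]} (hB : B ∈ padicBalls p) : IsCompact B := by
  obtain ⟨x, e, rfl⟩ := exists_closedBall_of_mem_padicBalls hB
  exact isCompact_closedBall _ _

theorem heightMeasurable_of_mem_padicBalls {B : Set ℚ_[p]} (hB : B ∈ padicBalls p) :
    HeightMeasurable B := by
  have hclosed := isClosed_of_mem_padicBalls hB
  obtain ⟨x, e, rfl⟩ := hB
  obtain ⟨N, hN, hper⟩ := padicPairs_periodic x (padic_zpow_pos (p := p) (-e))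
  have hdens : ∀ d : ℕ, ∃ c, HasBoxDensity
      {z | ((d : ℤ) * z.1, (d : ℤ) * z.2) ∈ padicPairs x ((p : ℝ) ^ (-e))} c := fun d =>
    -- Pulling back along multiplication by `d` preserves the period `N`. The density may depend on
    -- `d`: for `p ∣ d` the pullback is empty.
    exists_hasBoxDensity_of_periodic hN fun z z' h1 h2 hz =>
      hper _ _ (h1.mul_left _) (h2.mul_left _) hz
  choose c hc using hdens
  refine ⟨_, tendsto_proportion (fun r => ?_) fun d _ => hc d⟩
  have hden : (0 : ℝ) < ‖((r.den : ℤ) : ℚ_[p])‖ := by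
    rw [norm_pos_iff]
    exact_mod_cast r.den_nz
  have hdiv : ¬((p : ℤ) ∣ r.num ∧ (p : ℤ) ∣ (r.den : ℤ)) := by
    rintro ⟨h1, h2⟩
    have h3 := Nat.dvd_gcd (Int.natCast_dvd.1 h1) (Int.natCast_dvd_natCast.1 h2)
    rw [r.reduced.gcd_eq_one] at h3
    exact (Fact.out : p.Prime).one_lt.ne' (Nat.dvd_one.1 h3)
  rw [hclosed.closure_eq]
  simp only [padicPairs, Set.mem_ofPred_eq, hdiv, not_false_eq_true, true_and]
  rw [← div_le_iff₀ hden, ← norm_div]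
  have e1 : (x * ((r.den : ℤ) : ℚ_[p]) - (r.num : ℚ_[p])) / ((r.den : ℤ) : ℚ_[p]) =
      x - (r : ℚ_[p]) := by
    rw [sub_div, mul_div_cancel_right₀ _ (norm_pos_iff.1 hden), Rat.cast_def]
    simp
  rw [e1]

theorem heightMeasure_le_muStar_of_mem_padicBalls {B : Set ℚ_[p]} (hB : B ∈ padicBalls p) :
    heightMeasure B ≤ muStar (padicBalls p) B := by
  refine le_trans ?_ (le_iSup₂_of_le (1 : ℝ) zero_lt_one le_rfl)
  unfold muDelta
  refine le_iInf fun I => le_iInf fun C => le_iInf₂ fun hC hcov => ?_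
  obtain ⟨I', hI', hfin, hcov'⟩ := (isCompact_of_mem_padicBalls hB).elim_finite_subcover_image
    (fun i hi => isOpen_of_mem_padicBalls (hC i hi).1) hcov
  have hmem : ∀ i ∈ hfin.toFinset, C i ∈ padicBalls p := fun i hi =>
    (hC i (hI' (hfin.mem_toFinset.1 hi))).1
  refine (heightMeasure_le_sum (F := hfin.toFinset) (C := C)
    (heightMeasurable_of_mem_padicBalls hB)
    (fun i hi => heightMeasurable_of_mem_padicBalls (hmem i hi)) ?_).trans ?_
  · rw [(isClosed_of_mem_padicBalls hB).closure_eq]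
    intro y hy
    obtain ⟨i, hi, hyi⟩ := Set.mem_iUnion₂.1 (hcov' hy)
    exact Set.mem_iUnion₂.2 ⟨i, hfin.mem_toFinset.2 hi, subset_closure hyi⟩
  · rw [tsum_subtype I fun i => heightMeasure (C i)]
    refine le_trans (Finset.sum_le_sum fun i hi => ?_) (ENNReal.sum_le_tsum hfin.toFinset)
    rw [Set.indicator_of_mem (hI' (hfin.mem_toFinset.1 hi))]

theorem pre_le_heightMeasure_of_mem_padicBalls {B : Set ℚ_[p]} (hB : B ∈ padicBalls p)
    {δ : ℝ} (hδ : 0 < δ) :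
    OuterMeasure.mkMetric'.pre (ballMeasure (padicBalls p)) (ENNReal.ofReal δ) B ≤
      heightMeasure B := by
  classical
  obtain ⟨x, e, hxe⟩ := exists_closedBall_of_mem_padicBalls hB
  have hp : (1 : ℝ) < p := by exact_mod_cast (Fact.out : p.Prime).one_lt
  -- The factor `2` comes from bounding a diameter by twice the radius with the ordinary triangle
  -- inequality.
  obtain ⟨k, hk⟩ := exists_pow_lt_of_lt_one (show 0 < δ / (2 * (p : ℝ) ^ (-e)) from
    div_pos hδ (mul_pos two_pos (padic_zpow_pos _))) (inv_lt_one_of_one_lt₀ hp)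
  set ρ : ℝ := (p : ℝ) ^ (-(e + k)) with hρdef
  have hρ : ρ = (p : ℝ) ^ (-e) * (p : ℝ)⁻¹ ^ k := by
    rw [hρdef, neg_add, zpow_add₀ (by positivity), zpow_neg _ (k : ℤ), zpow_natCast, inv_pow]
  have hρ0 : 0 < ρ := padic_zpow_pos _
  have hρe : ρ ≤ (p : ℝ) ^ (-e) := zpow_le_zpow_right₀ hp.le (by omega)
  have hρδ : 2 * ρ ≤ δ := by
    rw [lt_div_iff₀ (mul_pos two_pos (padic_zpow_pos _))] at hk
    rw [hρ]
    linarith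
  obtain ⟨t, ht, hcov⟩ := (isCompact_of_mem_padicBalls hB).elim_nhds_subcover
    (fun y => Metric.closedBall y ρ) fun y _ => Metric.closedBall_mem_nhds y hρ0
  -- Indexing by the balls rather than their centres removes repetitions: distinct balls of equal
  -- radius are disjoint.
  set F : Finset (Set ℚ_[p]) := t.image fun y => Metric.closedBall y ρ with hF
  have hFball : ∀ s ∈ F, s ∈ padicBalls p := by
    intro s hs
    obtain ⟨y, -, rfl⟩ := Finset.mem_image.1 hs
    exact closedBall_mem_padicBalls y _
  have hFdiam : ∀ s ∈ F, Metric.ediam s ≤ ENNReal.ofReal δ := by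
    intro s hs
    obtain ⟨y, -, rfl⟩ := Finset.mem_image.1 hs
    refine Metric.ediam_le_of_forall_dist_le fun a ha b hb => ?_
    exact (dist_triangle_right a b y).trans
      (by linarith [Metric.mem_closedBall.1 ha, Metric.mem_closedBall.1 hb])
  have hBF : B ⊆ ⋃ s ∈ F, s := by
    intro z hz
    obtain ⟨y, hy, hzy⟩ := Set.mem_iUnion₂.1 (hcov hz)
    exact Set.mem_iUnion₂.2 ⟨_, Finset.mem_image_of_mem _ hy, hzy⟩
  refine (measure_mono hBF).trans ((measure_biUnion_finset_le _ _).trans ?_)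
  refine le_trans (Finset.sum_le_sum fun s hs => ?_) (sum_le_heightMeasure (F := F) (C := id)
    (heightMeasurable_of_mem_padicBalls hB)
    (fun s hs => heightMeasurable_of_mem_padicBalls (hFball s hs)) ?_ ?_)
  · refine (OuterMeasure.mkMetric'.pre_le (hFdiam s hs)).trans ?_
    simp [ballMeasure, hFball s hs]
  · intro s hs
    obtain ⟨y, hy, rfl⟩ := Finset.mem_image.1 hs
    refine closure_mono ?_
    have hyB := ht y hy
    rw [hxe] at hyB ⊢
    rw [IsUltrametricDist.closedBall_eq_of_mem hyB]
    exact Metric.closedBall_subset_closedBall hρe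
  · intro s hs s' hs' hne
    simp only [Function.onFun, id, (isClosed_of_mem_padicBalls (hFball s hs)).closure_eq,
      (isClosed_of_mem_padicBalls (hFball s' hs')).closure_eq]
    obtain ⟨y, -, rfl⟩ := Finset.mem_image.1 hs
    obtain ⟨y', -, rfl⟩ := Finset.mem_image.1 hs'
    exact (IsUltrametricDist.closedBall_eq_or_disjoint y y' ρ).resolve_left hne

end Padic

/-! ### The infinite place. -/

section Real

/-- The points `(x, y)` of `[-1, 1] × (0, 1]`. -/
def unitBox : Set (Fin 2 → ℝ) := {v | (-1 ≤ v 0 ∧ v 0 ≤ 1) ∧ 0 < v 1 ∧ v 1 ≤ 1}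

/-- The points `(x, y)` of the unit box with `a ≤ x / y ≤ b`. -/
def sector (a b : ℝ) : Set (Fin 2 → ℝ) := {v | v ∈ unitBox ∧ a * v 1 ≤ v 0 ∧ v 0 ≤ b * v 1}

theorem measurableSet_unitBox : MeasurableSet unitBox := by
  unfold unitBox
  measurability

theorem convex_sector (a b : ℝ) : Convex ℝ (sector a b) := by
  rintro u ⟨⟨⟨h1, h2⟩, h3, h4⟩, h5, h6⟩ v ⟨⟨⟨k1, k2⟩, k3, k4⟩, k5, k6⟩ s t hs ht hst
  simp only [sector, unitBox, Set.mem_ofPred_eq, Pi.add_apply, Pi.smul_apply, smul_eq_mul]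
  have e : t = 1 - s := by linarith
  subst e
  refine ⟨⟨⟨?_, ?_⟩, ?_, ?_⟩, ?_, ?_⟩
  · nlinarith
  · nlinarith
  · rcases hs.eq_or_lt with rfl | hs'
    · simpa using k3
    · have := mul_pos hs' h3
      have := mul_nonneg ht k3.le
      linarith
  · nlinarith
  · nlinarith [mul_le_mul_of_nonneg_left h5 hs, mul_le_mul_of_nonneg_left k5 ht]
  · nlinarith [mul_le_mul_of_nonneg_left h6 hs, mul_le_mul_of_nonneg_left k6 ht]

theorem measurableSet_sector (a b : ℝ) : MeasurableSet (sector a b) := by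
  have h0 : Measurable fun v : Fin 2 → ℝ => v 0 := measurable_pi_apply 0
  have h1 : Measurable fun v : Fin 2 → ℝ => v 1 := measurable_pi_apply 1
  exact measurableSet_unitBox.inter
    ((measurableSet_le (h1.const_mul a) h0).inter (measurableSet_le h0 (h1.const_mul b)))

theorem unitBox_subset_Icc : unitBox ⊆ Set.Icc (fun _ => -1) (fun _ => 1) := by
  rintro v ⟨⟨h1, h2⟩, h3, h4⟩
  constructor <;> intro i <;> fin_cases i <;> simp <;> linarith

theorem isBounded_sector (a b : ℝ) : Bornology.IsBounded (sector a b) :=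
  (Metric.isBounded_Icc _ _).subset fun _ hv => unitBox_subset_Icc hv.1

/-- The pairs `(m, n)` with `a ≤ m / n ≤ b`. -/
def sectorPairs (a b : ℝ) : Set (ℤ × ℤ) := {z | a * z.2 ≤ z.1 ∧ (z.1 : ℝ) ≤ b * z.2}

open Pointwise in
theorem card_sector_inter (a b : ℝ) {T : ℕ} (hT : 0 < T) :
    Nat.card ↑(sector a b ∩ (T : ℝ)⁻¹ •
      (Submodule.span ℤ (Set.range (Pi.basisFun ℝ (Fin 2))) : Set (Fin 2 → ℝ))) =
      boxCount (sectorPairs a b) T := by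
  classical
  have : NeZero T := ⟨hT.ne'⟩
  have hT' : (0 : ℝ) < T := by exact_mod_cast hT
  set f : ℤ × ℤ → Fin 2 → ℝ := fun z => ![z.1 / T, z.2 / T] with hf
  have hinj : Function.Injective f := by
    intro z w hzw
    have h0 := congrFun hzw 0
    have h1 := congrFun hzw 1
    simp only [hf, Matrix.cons_val_zero, Matrix.cons_val_one, div_left_inj' hT'.ne', Int.cast_inj]
      at h0 h1
    exact Prod.ext h0 h1
  rw [Nat.card_coe_set_eq, boxCount, ← Set.ncard_coe_finset, ← Set.ncard_image_of_injective _ hinj]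
  congr 1
  -- The strict bound `0 < v 1` of the unit box becomes `1 ≤ n` on integers.
  have hiff : ∀ z : ℤ × ℤ, f z ∈ sector a b ↔ z ∈ box T ∧ z ∈ sectorPairs a b := by
    rintro ⟨m, n⟩
    simp only [sector, unitBox, sectorPairs, mem_box, hf, Set.mem_ofPred_eq, Matrix.cons_val_zero,
      Matrix.cons_val_one]
    rw [le_div_iff₀ hT', div_le_iff₀ hT', div_le_iff₀ hT', div_pos_iff_of_pos_right hT',
      mul_div_assoc', mul_div_assoc', div_le_div_iff_of_pos_right hT',
      div_le_div_iff_of_pos_right hT', neg_one_mul, one_mul]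
    norm_cast
  ext v
  constructor
  · rintro ⟨hv, hL⟩
    have hL' := (BoxIntegral.unitPartition.mem_smul_span_iff (n := T)).1 hL
    obtain ⟨m, hm⟩ := hL' 0
    obtain ⟨n, hn⟩ := hL' 1
    have hfv : f (m, n) = v := by
      ext i
      fin_cases i
      · simp only [eq_intCast] at hm
        simp [hf, hm, hT'.ne']
      · simp only [eq_intCast] at hn
        simp [hf, hn, hT'.ne']
    refine ⟨(m, n), ?_, hfv⟩
    rw [← hfv, hiff] at hv
    simpa using hv
  · rintro ⟨z, hz, rfl⟩
    refine ⟨(hiff z).2 (by simpa using hz), ?_⟩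
    refine (BoxIntegral.unitPartition.mem_smul_span_iff (n := T)).2 fun i => ?_
    fin_cases i
    · exact ⟨z.1, by simp [hf, mul_div_cancel₀, hT'.ne']⟩
    · exact ⟨z.2, by simp [hf, mul_div_cancel₀, hT'.ne']⟩

/-- Lattice points of mesh `1 / T` in a bounded measurable set are counted by its volume if the
frontier is null, which convexity ensures. -/
theorem hasBoxDensity_sectorPairs (a b : ℝ) :
    HasBoxDensity (sectorPairs a b) (volume.real (sector a b)) := by
  refine (tendsto_card_div_pow_atTop_volume (sector a b) (isBounded_sector a b)
    (measurableSet_sector a b) ((convex_sector a b).addHaar_frontier volume)).congr' ?_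
  filter_upwards [eventually_gt_atTop 0] with T hT
  rw [← card_sector_inter a b hT, Fintype.card_fin]

theorem tendsto_proportion_of_closure_eq_Icc {U : Set ℝ} {a b : ℝ} (h : closure U = Set.Icc a b) :
    Tendsto (proportion U) atTop (𝓝 (volume.real (sector a b) / 2)) := by
  refine tendsto_proportion_of_scaling (S := sectorPairs a b) (fun r => ?_) (fun d hd z => ?_)
    (hasBoxDensity_sectorPairs a b)
  · have hden : (0 : ℝ) < r.den := by exact_mod_cast r.den_pos
    rw [h, Set.mem_Icc, Rat.cast_def, le_div_iff₀ hden, div_le_iff₀ hden]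
    simp [sectorPairs]
  · have hd' : (0 : ℝ) < d := by exact_mod_cast hd
    simp only [sectorPairs, Set.mem_ofPred_eq]
    push_cast
    rw [mul_left_comm a, mul_left_comm b, mul_le_mul_iff_right₀ hd', mul_le_mul_iff_right₀ hd']

/-- The distribution of `x / y` for `(x, y)` uniformly distributed in `[-1, 1] × (0, 1]`. -/
noncomputable def ratioMeasure : Measure ℝ :=
  (2⁻¹ : ℝ≥0∞) • (volume.restrict unitBox).map fun v => v 0 / v 1

theorem ratioMeasure_Icc (a b : ℝ) :
    ratioMeasure (Set.Icc a b) = ENNReal.ofReal (volume.real (sector a b) / 2) := by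
  have hmeas : Measurable fun v : Fin 2 → ℝ => v 0 / v 1 := by fun_prop
  have hpre : (fun v : Fin 2 → ℝ => v 0 / v 1) ⁻¹' Set.Icc a b ∩ unitBox = sector a b := by
    ext v
    simp only [Set.mem_inter_iff, Set.mem_preimage, Set.mem_Icc, sector, Set.mem_ofPred_eq]
    rw [and_comm]
    refine and_congr_right fun hv => ?_
    rw [le_div_iff₀ hv.2.1, div_le_iff₀ hv.2.1]
  rw [ratioMeasure, Measure.smul_apply, Measure.map_apply hmeas measurableSet_Icc,
    Measure.restrict_apply (hmeas measurableSet_Icc), hpre, smul_eq_mul,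
    ENNReal.ofReal_div_of_pos two_pos, ofReal_measureReal (isBounded_sector a b).measure_lt_top.ne,
    ENNReal.ofReal_ofNat, mul_comm, div_eq_mul_inv]

/-- The degenerate sector lies on a line, a proper subspace. Hence `ratioMeasure` has no atoms and
ignores endpoints of intervals. -/
theorem volume_sector_self (a : ℝ) : volume (sector a a) = 0 := by
  set φ : (Fin 2 → ℝ) →ₗ[ℝ] ℝ := LinearMap.proj 0 - a • LinearMap.proj 1 with hφ
  have hker : LinearMap.ker φ ≠ ⊤ := by
    intro h
    have : (![1, 0] : Fin 2 → ℝ) ∈ LinearMap.ker φ := h ▸ Submodule.mem_top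
    simp [hφ] at this
  refine measure_mono_null ?_ (Measure.addHaar_submodule volume _ hker)
  rintro v ⟨-, h1, h2⟩
  simp [hφ, le_antisymm h2 h1]

instance : NullSingletonClass ratioMeasure where
  measure_singleton a := by
    rw [← Set.Icc_self, ratioMeasure_Icc, Measure.real, volume_sector_self]
    simp

/-- A real ball lies between an open interval and its closure. -/
theorem exists_Icc_of_mem_realBalls {B : Set ℝ} (hB : B ∈ realBalls) :
    ∃ a b : ℝ, a < b ∧ B ⊆ Set.Icc a b ∧ closure B = Set.Icc a b ∧
      ratioMeasure B = ratioMeasure (Set.Icc a b) := by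
  obtain ⟨a, b, hab, rfl | rfl | rfl | rfl⟩ := hB
  · exact ⟨a, b, hab, subset_rfl, closure_Icc a b, rfl⟩
  · exact ⟨a, b, hab, Set.Ioo_subset_Icc_self, closure_Ioo hab.ne, measure_congr Ioo_ae_eq_Icc⟩
  · exact ⟨a, b, hab, Set.Ico_subset_Icc_self, closure_Ico hab.ne, measure_congr Ico_ae_eq_Icc⟩
  · exact ⟨a, b, hab, Set.Ioc_subset_Icc_self, closure_Ioc hab.ne, measure_congr Ioc_ae_eq_Icc⟩

theorem heightMeasurable_of_mem_realBalls {B : Set ℝ} (hB : B ∈ realBalls) :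
    HeightMeasurable B := by
  obtain ⟨a, b, -, -, hcl, -⟩ := exists_Icc_of_mem_realBalls hB
  exact ⟨_, tendsto_proportion_of_closure_eq_Icc hcl⟩

theorem heightMeasure_eq_ratioMeasure {B : Set ℝ} (hB : B ∈ realBalls) :
    heightMeasure B = ratioMeasure B := by
  obtain ⟨a, b, -, -, hcl, hr⟩ := exists_Icc_of_mem_realBalls hB
  rw [heightMeasure_eq (tendsto_proportion_of_closure_eq_Icc hcl), hr, ratioMeasure_Icc]

/-- No compactness is needed: `mkMetric'.pre` is the largest outer measure bounded by the given
values on small sets, so it dominates `ratioMeasure`. -/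
theorem heightMeasure_le_muStar_of_mem_realBalls {B : Set ℝ} (hB : B ∈ realBalls) :
    heightMeasure B ≤ muStar realBalls B := by
  refine le_trans ?_ (le_iSup₂_of_le (1 : ℝ) zero_lt_one le_rfl)
  rw [muDelta_eq, heightMeasure_eq_ratioMeasure hB]
  refine (OuterMeasure.mkMetric'.le_pre (μ := ratioMeasure.toOuterMeasure)).2 (fun s _ => ?_) B
  exact le_iInf fun hs => (heightMeasure_eq_ratioMeasure hs).ge

/-- Bisecting `k` times gives intervals of length at most `δ`. Neighbouring halves share an
endpoint, so `sum_le_heightMeasure` does not apply; additivity comes from `ratioMeasure`, which has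
no atoms. -/
theorem pre_Icc_le_ratioMeasure {δ : ℝ} (k : ℕ) :
    ∀ a b : ℝ, a < b → b - a ≤ 2 ^ k * δ →
      OuterMeasure.mkMetric'.pre (ballMeasure realBalls) (ENNReal.ofReal δ) (Set.Icc a b) ≤
        ratioMeasure (Set.Icc a b) := by
  induction k with
  | zero =>
    intro a b hab hδ
    have hmem : Set.Icc a b ∈ realBalls := ⟨a, b, hab, Or.inl rfl⟩
    refine (OuterMeasure.mkMetric'.pre_le ?_).trans ?_
    · rw [Real.ediam_Icc]
      exact ENNReal.ofReal_le_ofReal (by simpa using hδ)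
    · exact iInf_le_of_le hmem (heightMeasure_eq_ratioMeasure hmem).le
  | succ k ih =>
    intro a b hab hδ
    rw [pow_succ] at hδ
    have h1 : a < (a + b) / 2 := by linarith
    have h2 : (a + b) / 2 < b := by linarith
    calc _ ≤ _ := measure_mono (Set.Icc_union_Icc_eq_Icc h1.le h2.le).ge
      _ ≤ _ := measure_union_le _ _
      _ ≤ ratioMeasure (Set.Icc a ((a + b) / 2)) + ratioMeasure (Set.Icc ((a + b) / 2) b) :=
        add_le_add (ih _ _ h1 (by linarith)) (ih _ _ h2 (by linarith))
      _ = ratioMeasure (Set.Ioc a ((a + b) / 2)) + ratioMeasure (Set.Ioc ((a + b) / 2) b) := by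
        rw [measure_congr Ioc_ae_eq_Icc, measure_congr Ioc_ae_eq_Icc]
      _ = ratioMeasure (Set.Icc a b) := by
        rw [← measure_union (Set.Ioc_disjoint_Ioc_of_le le_rfl) measurableSet_Ioc,
          Set.Ioc_union_Ioc_eq_Ioc h1.le h2.le, measure_congr Ioc_ae_eq_Icc]

theorem pre_le_heightMeasure_of_mem_realBalls {B : Set ℝ} (hB : B ∈ realBalls) {δ : ℝ}
    (hδ : 0 < δ) :
    OuterMeasure.mkMetric'.pre (ballMeasure realBalls) (ENNReal.ofReal δ) B ≤
      heightMeasure B := by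
  rw [heightMeasure_eq_ratioMeasure hB]
  obtain ⟨a, b, hab, hsub, -, hr⟩ := exists_Icc_of_mem_realBalls hB
  obtain ⟨k, hk⟩ := pow_unbounded_of_one_lt ((b - a) / δ) one_lt_two
  rw [hr]
  exact (measure_mono hsub).trans
    (pre_Icc_le_ratioMeasure k a b hab ((div_lt_iff₀ hδ).1 hk).le)

end Real

end HeightMeasure

theorem theorem2 :
    -- the finite places
    (∀ (p : ℕ) [Fact p.Prime], ∃ ν : OuterMeasure ℚ_[p],
      (∀ E : Set ℚ_[p], ν E = HeightMeasure.muStar (HeightMeasure.padicBalls p) E) ∧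
      (∀ A : ℕ → Set ℚ_[p], (∀ n, ν.IsCaratheodory (A n)) → Pairwise (Function.onFun Disjoint A) →
        ν (⋃ n, A n) = ∑' n, ν (A n)) ∧
      (∀ A : Set ℚ_[p], MeasurableSet[borel ℚ_[p]] A → ν.IsCaratheodory A) ∧
      (∀ B ∈ HeightMeasure.padicBalls p,
        HeightMeasure.HeightMeasurable B ∧ ν B = HeightMeasure.heightMeasure B)) ∧
    -- the infinite place
    (∃ ν : OuterMeasure ℝ,
      (∀ E : Set ℝ, ν E = HeightMeasure.muStar HeightMeasure.realBalls E) ∧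
      (∀ A : ℕ → Set ℝ, (∀ n, ν.IsCaratheodory (A n)) → Pairwise (Function.onFun Disjoint A) →
        ν (⋃ n, A n) = ∑' n, ν (A n)) ∧
      (∀ A : Set ℝ, MeasurableSet[borel ℝ] A → ν.IsCaratheodory A) ∧
      (∀ B ∈ HeightMeasure.realBalls,
        HeightMeasure.HeightMeasurable B ∧ ν B = HeightMeasure.heightMeasure B)) :=
  ⟨fun _ _ => HeightMeasure.exists_outerMeasure
      (fun _ hB => HeightMeasure.heightMeasurable_of_mem_padicBalls hB)
      (fun _ hB => HeightMeasure.heightMeasure_le_muStar_of_mem_padicBalls hB)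
      (fun _ hB _ hδ => HeightMeasure.pre_le_heightMeasure_of_mem_padicBalls hB hδ),
    HeightMeasure.exists_outerMeasure
      (fun _ hB => HeightMeasure.heightMeasurable_of_mem_realBalls hB)
      (fun _ hB => HeightMeasure.heightMeasure_le_muStar_of_mem_realBalls hB)
      (fun _ hB _ hδ => HeightMeasure.pre_le_heightMeasure_of_mem_realBalls hB hδ)⟩
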